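/- For a positive integer $n$, let $\|n\|$ denote the integer complexity of $n$: the least number of $1$'s in an expression for $n$ built from $1$'s by addition, multiplication and parentheses. The defect of $n$ is the real number $\delta(n)=\|n\|-3\log_3 n$, and $n$ is called stable if $\|3^k n\|=3k+\|n\|$ for every integer $k\ge 0$. Let $\mathscr{D}_{\mathrm{st}}=\{\delta(n): n \text{ a stable positive integer}\}$ and, for a congruence class $u$ modulo $3$, let $$\mathscr{D}^u=\{\delta(n): n>1,\ \|n\|\equiv u \pmod 3\},\qquad \mathscr{D}^u_{\mathrm{st}}=\mathscr{D}^u\cap\mathscr{D}_{\mathrm{st}}.$$ For $S\subseteq\mathbb{R}$, write $\overline{S}$ for its closure in $\mathbb{R}$, $S'$ for the set of its limit (accumulation) points in $\mathbb{R}$, and $S+c=\{s+c : s\in S\}$. Then, for every congruence class $u$ modulo $3$, $$\overline{\mathscr{D}^u_{\mathrm{st}}}\,' = \overline{\mathscr{D}^{u-1}_{\mathrm{st}}}+1 \qquad\text{and}\qquad \overline{\mathscr{D}^u_{\mathrm{st}}}\,''' = \overline{\mathscr{D}^u_{\mathrm{st}}}+3 .$$ -/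

import Mathlib

namespace IntegerComplexity

/-- Fully parenthesized expressions built from `1` by addition and multiplication. -/
inductive OneExpr : Type
  | one : OneExpr
  | add : OneExpr → OneExpr → OneExpr
  | mul : OneExpr → OneExpr → OneExpr

/-- The natural number denoted by an expression. -/
def OneExpr.val : OneExpr → ℕ
  | .one => 1
  | .add a b => a.val + b.val
  | .mul a b => a.val * b.val

/-- The number of `1`'s occurring in an expression. -/
def OneExpr.ones : OneExpr → ℕ
  | .one => 1
  | .add a b => a.ones + b.ones
  | .mul a b => a.ones + b.ones

/-- Every positive natural number is the value of some expression. -/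
theorem exists_oneExpr (n : ℕ) (hn : 0 < n) : ∃ e : OneExpr, e.val = n := by
  induction n, hn using Nat.le_induction with
  | base => exact ⟨.one, rfl⟩
  | succ m _ ih =>
    obtain ⟨e, he⟩ := ih
    exact ⟨.add e .one, by simp [OneExpr.val, he]⟩

/-- The complexity of `n`: the least number of `1`'s in an expression with value `n`.
It is meaningful for `0 < n`, where such expressions exist. -/
noncomputable def complexity (n : ℕ) : ℕ :=
  sInf {c : ℕ | ∃ e : OneExpr, e.val = n ∧ e.ones = c}

/-- The complexity of a positive number is attained. -/
theorem exists_oneExpr_ones_eq_complexity (n : ℕ) (hn : 0 < n) :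
    ∃ e : OneExpr, e.val = n ∧ e.ones = complexity n := by
  obtain ⟨e, he⟩ := exists_oneExpr n hn
  exact Nat.sInf_mem (s := {c : ℕ | ∃ e : OneExpr, e.val = n ∧ e.ones = c}) ⟨e.ones, e, he, rfl⟩

/-- The defect `δ(n) = ‖n‖ - 3 log₃ n`. -/
noncomputable def defect (n : ℕ) : ℝ :=
  (complexity n : ℝ) - 3 * Real.logb 3 (n : ℝ)

/-- `n` is stable if `‖3 ^ k * n‖ = 3 * k + ‖n‖` for every `k ≥ 0`. -/
def IsStable (n : ℕ) : Prop :=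
  ∀ k : ℕ, complexity (3 ^ k * n) = 3 * k + complexity n

/-- The set of stable defects: the defects of stable positive integers. -/
def stableDefects : Set ℝ :=
  {x : ℝ | ∃ n : ℕ, 0 < n ∧ IsStable n ∧ defect n = x}

/-- `D^u`: the defects of the integers `n > 1` whose complexity is congruent to `u` modulo 3. -/
def defectsMod (u : ZMod 3) : Set ℝ :=
  {x : ℝ | ∃ n : ℕ, 1 < n ∧ (complexity n : ZMod 3) = u ∧ defect n = x}

/-- `D^u_st`: the stable defects that lie in `D^u`. -/
def stableDefectsMod (u : ZMod 3) : Set ℝ :=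
  defectsMod u ∩ stableDefects

end IntegerComplexity

namespace IntegerComplexity

/-! ### Elementary properties of the complexity -/

/-! Limit points arise only because adding a small number to a large one costs at least one `1` but
hardly changes the logarithm. By `exists_bounded_approx`, up to a factor near 1, every `n` of
bounded defect is `m * 3 ^ k` with `m` from a finite list, and some `j ≥ 1` ones are saved unless
equality holds. Near a limit point `η` the finitely many defects coming from the list can be
avoided, so `η - j` lies in the closure of stable defects of class `u - j` for some `j ≥ 1`. Defects
are nonnegative, so repeating this descent ends with `η = δ(m) + j`, `m` stable
(`exists_defect_add_of_mem_derivedSet`). Conversely, the numbers `3 ^ k * n + 1` accumulate at `δ(n)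
+ 1` (`defect_add_one_mem_derivedSet`); that they save no further ones infinitely often follows from
the first half, since stable defects differing by an integer are equal. Taking derived sets three
times shifts by 3 and returns to the class `u`. -/

theorem OneExpr.ones_pos (e : OneExpr) : 0 < e.ones := by
  induction e with
  | one => exact Nat.one_pos
  | add a b ha hb => exact Nat.add_pos_left ha _
  | mul a b ha hb => exact Nat.add_pos_left ha _

theorem OneExpr.val_pos (e : OneExpr) : 0 < e.val := by
  induction e with
  | one => exact Nat.one_pos
  | add a b ha hb => exact Nat.add_pos_left ha _
  | mul a b ha hb => exact Nat.mul_pos ha hb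

theorem OneExpr.complexity_val_le (e : OneExpr) : complexity e.val ≤ e.ones :=
  Nat.sInf_le ⟨e, rfl, rfl⟩

theorem complexity_pos {n : ℕ} (hn : 0 < n) : 0 < complexity n := by
  obtain ⟨e, -, he⟩ := exists_oneExpr_ones_eq_complexity n hn
  exact he ▸ e.ones_pos

theorem complexity_one : complexity 1 = 1 :=
  le_antisymm (OneExpr.one.complexity_val_le) (complexity_pos Nat.one_pos)

theorem complexity_add_le {a b : ℕ} (ha : 0 < a) (hb : 0 < b) :
    complexity (a + b) ≤ complexity a + complexity b := by
  obtain ⟨e, rfl, he⟩ := exists_oneExpr_ones_eq_complexity a ha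
  obtain ⟨f, rfl, hf⟩ := exists_oneExpr_ones_eq_complexity b hb
  rw [← he, ← hf]
  exact (OneExpr.add e f).complexity_val_le

theorem complexity_mul_le {a b : ℕ} (ha : 0 < a) (hb : 0 < b) :
    complexity (a * b) ≤ complexity a + complexity b := by
  obtain ⟨e, rfl, he⟩ := exists_oneExpr_ones_eq_complexity a ha
  obtain ⟨f, rfl, hf⟩ := exists_oneExpr_ones_eq_complexity b hb
  rw [← he, ← hf]
  exact (OneExpr.mul e f).complexity_val_le

theorem complexity_three_le : complexity 3 ≤ 3 :=
  (OneExpr.add (.add .one .one) .one).complexity_val_le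

theorem complexity_three_pow_mul_le {n : ℕ} (hn : 0 < n) (k : ℕ) :
    complexity (3 ^ k * n) ≤ 3 * k + complexity n := by
  induction k with
  | zero => simp
  | succ k ih =>
    have h := complexity_mul_le (a := 3) (b := 3 ^ k * n) (by norm_num) (by positivity)
    have h3 := complexity_three_le
    rw [pow_succ', mul_assoc]
    omega

/-- An optimal expression of a number greater than `1` is a sum or a nontrivial product. -/
theorem exists_efficient_add_or_mul {n : ℕ} (hn : 1 < n) :
    (∃ a b, 0 < b ∧ b ≤ a ∧ n = a + b ∧ complexity n = complexity a + complexity b) ∨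
      ∃ a b, 1 < a ∧ 1 < b ∧ n = a * b ∧ complexity n = complexity a + complexity b := by
  obtain ⟨e, rfl, he⟩ := exists_oneExpr_ones_eq_complexity n (by omega)
  cases e with
  | one => exact absurd hn (lt_irrefl _)
  | add a b =>
    left
    have h1 := complexity_add_le a.val_pos b.val_pos
    have h2 := a.complexity_val_le
    have h3 := b.complexity_val_le
    simp only [OneExpr.val, OneExpr.ones] at he ⊢
    rcases le_total b.val a.val with h | h
    · exact ⟨a.val, b.val, b.val_pos, h, rfl, by omega⟩
    · exact ⟨b.val, a.val, a.val_pos, h, add_comm _ _, by omega⟩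
  | mul a b =>
    right
    have h1 := complexity_mul_le a.val_pos b.val_pos
    have h2 := a.complexity_val_le
    have h3 := b.complexity_val_le
    have ha := a.ones_pos
    have hb := b.ones_pos
    have ha' := a.val_pos
    have hb' := b.val_pos
    simp only [OneExpr.val, OneExpr.ones] at he ⊢
    refine ⟨a.val, b.val, ?_, ?_, rfl, by omega⟩
    · by_contra h
      have h : a.val = 1 := by omega
      rw [h, one_mul] at he
      omega
    · by_contra h
      have h : b.val = 1 := by omega
      rw [h, mul_one] at he
      omega

/-- This is `δ(n) ≥ 0` without logarithms. Induction on the last operation: a sum of two numbers at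
least 2 is at most their product, so only `a + 1` needs separate care. -/
theorem cube_le_three_pow_complexity {n : ℕ} (hn : 0 < n) : n ^ 3 ≤ 3 ^ complexity n := by
  induction n using Nat.strong_induction_on with
  | _ n ih =>
  rcases (show n = 1 ∨ 1 < n by omega) with rfl | h1
  · simp [complexity_one]
  rcases exists_efficient_add_or_mul h1 with ⟨a, b, hb, hba, rfl, hc⟩ | ⟨a, b, ha, hb, rfl, hc⟩
  · have iha := ih a (by omega) (by omega)
    have ihb := ih b (by omega) hb
    rw [hc, pow_add]
    rcases (show b = 1 ∨ 2 ≤ b by omega) with rfl | hb2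
    · rw [complexity_one]
      rcases (show a = 1 ∨ a = 2 ∨ 3 ≤ a by omega) with rfl | rfl | ha
      · simp [complexity_one]
      · have : 2 ≤ complexity 2 := by
          by_contra h
          have h' : 3 ^ complexity 2 ≤ 3 ^ 1 := Nat.pow_le_pow_right (by norm_num) (by omega)
          omega
        have := Nat.pow_le_pow_right (n := 3) (by norm_num) this
        omega
      · have h : (3 * (a + 1)) ^ 3 ≤ (4 * a) ^ 3 := Nat.pow_le_pow_left (by omega) 3
        rw [mul_pow, mul_pow] at h
        omega
    · have h : a + b ≤ a * b := by nlinarith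
      calc (a + b) ^ 3 ≤ (a * b) ^ 3 := Nat.pow_le_pow_left h 3
        _ = a ^ 3 * b ^ 3 := mul_pow _ _ _
        _ ≤ _ := Nat.mul_le_mul iha ihb
  · rw [hc, pow_add, mul_pow]
    exact Nat.mul_le_mul (ih a (by nlinarith) (by omega)) (ih b (by nlinarith) (by omega))

/-- Numbers other than the powers of `3` have defect at least `2 - 3 log₃ 2 = log₃ (9 / 8)`. -/
theorem eq_three_pow_or_le {n : ℕ} (hn : 0 < n) :
    (∃ k, n = 3 ^ k) ∨ 9 * n ^ 3 ≤ 8 * 3 ^ complexity n := by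
  induction n using Nat.strong_induction_on with
  | _ n ih =>
  rcases (show n = 1 ∨ 1 < n by omega) with rfl | h1
  · exact .inl ⟨0, rfl⟩
  rcases exists_efficient_add_or_mul h1 with ⟨a, b, hb, hba, rfl, hc⟩ | ⟨a, b, ha, hb, rfl, hc⟩
  · have ha' := cube_le_three_pow_complexity (n := a) (by omega)
    have hb' := cube_le_three_pow_complexity hb
    rw [hc, pow_add]
    rcases (show b = 1 ∨ 2 ≤ b by omega) with rfl | hb2
    · rw [complexity_one]
      rcases (show a = 1 ∨ a = 2 ∨ 3 ≤ a by omega) with rfl | rfl | ha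
      · simp [complexity_one]
      · exact .inl ⟨1, rfl⟩
      · have h : (3 * (a + 1)) ^ 3 ≤ (4 * a) ^ 3 := Nat.pow_le_pow_left (by omega) 3
        rw [mul_pow, mul_pow] at h
        omega
    · right
      have hm := Nat.mul_le_mul ha' hb'
      rcases (show a = 2 ∨ 3 ≤ a by omega) with rfl | ha
      · obtain rfl : b = 2 := by omega
        have : 2 ≤ complexity 2 := by
          by_contra h
          have h' : 3 ^ complexity 2 ≤ 3 ^ 1 := Nat.pow_le_pow_right (by norm_num) (by omega)
          omega
        have := Nat.pow_le_pow_right (n := 3) (by norm_num) this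
        nlinarith
      -- The ratio `(a + b) / (a * b)` is at most `5 / 6`, attained at `a = 3`, `b = 2`, and `9 * (5
      -- / 6) ^ 3 < 8`.
      · have h : (6 * (a + b)) ^ 3 ≤ (5 * (a * b)) ^ 3 := Nat.pow_le_pow_left (by nlinarith) 3
        rw [mul_pow, mul_pow, mul_pow] at h
        omega
  · have ha' := cube_le_three_pow_complexity (n := a) (by omega)
    have hb' := cube_le_three_pow_complexity (n := b) (by omega)
    rw [hc, pow_add, mul_pow]
    rcases ih a (by nlinarith) (by omega) with ⟨i, hi⟩ | h
    · rcases ih b (by nlinarith) (by omega) with ⟨j, hj⟩ | h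
      · exact .inl ⟨i + j, by rw [hi, hj, pow_add]⟩
      · right
        nlinarith [Nat.mul_le_mul ha' h]
    · right
      nlinarith [Nat.mul_le_mul h hb']

/-! ### Stability -/

theorem IsStable.three_pow_mul {n : ℕ} (h : IsStable n) (k : ℕ) : IsStable (3 ^ k * n) := by
  intro j
  rw [← mul_assoc, ← pow_add, h, h]
  ring

theorem three_mul_le_complexity {n : ℕ} (hn : 0 < n) (k : ℕ) :
    3 * k ≤ complexity (3 ^ k * n) := by
  have h := cube_le_three_pow_complexity (n := 3 ^ k * n) (by positivity)
  have h' : 3 ^ (3 * k) ≤ (3 ^ k * n) ^ 3 := by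
    rw [mul_comm 3 k, pow_mul]
    exact Nat.pow_le_pow_left (Nat.le_mul_of_pos_right _ hn) 3
  exact (Nat.pow_le_pow_iff_right (by norm_num)).1 (h'.trans h)

/-- Take `k` minimising `‖3 ^ k * n‖ - 3 * k`. The truncated subtraction is exact by
`three_mul_le_complexity`. -/
theorem exists_isStable {n : ℕ} (hn : 0 < n) : ∃ k, IsStable (3 ^ k * n) := by
  let g : ℕ → ℕ := fun k => complexity (3 ^ k * n) - 3 * k
  obtain ⟨k, hk⟩ : ∃ k, ∀ j, g k ≤ g j := ⟨Function.argmin g, fun j => Function.argmin_le g j⟩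
  refine ⟨k, fun j => ?_⟩
  have h1 := three_mul_le_complexity hn k
  have h2 := three_mul_le_complexity hn (j + k)
  have h3 := hk (j + k)
  have h4 := complexity_three_pow_mul_le (n := 3 ^ k * n) (by positivity) j
  simp only [g] at h3
  rw [← mul_assoc, ← pow_add] at h4 ⊢
  omega

theorem not_isStable_one : ¬ IsStable 1 := by
  intro h
  have h1 := h 1
  have h3 := complexity_three_le
  rw [complexity_one] at h1
  norm_num at h1
  omega

theorem IsStable.one_lt {n : ℕ} (h : IsStable n) (hn : 0 < n) : 1 < n := by
  rcases (show n = 1 ∨ 1 < n by omega) with rfl | h1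
  · exact absurd h not_isStable_one
  · exact h1

/-! ### Approximation of numbers of bounded defect -/

/-- For every bound on the defect and every tolerance `τ`, finitely many `m` suffice to approximate
every `n` of bounded defect by some `m * 3 ^ k` up to a factor `1 + τ`, and the complexity strictly
drops unless `n = m * 3 ^ k`. -/
theorem exists_bounded_approx (r : ℕ) : ∀ τ : ℝ, 0 < τ → ∃ M : ℕ, ∀ n : ℕ, 0 < n →
    3 ^ complexity n * 8 ^ r ≤ n ^ 3 * 9 ^ r →
    ∃ m k l j : ℕ, 0 < m ∧ m ≤ M ∧ m * 3 ^ k ≤ n ∧ (n : ℝ) ≤ (1 + τ) * (m * 3 ^ k) ∧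
      complexity (3 ^ l * m) + 3 * k + j ≤ complexity n + 3 * l ∧ (j = 0 → n = m * 3 ^ k) := by
  induction r with
  | zero =>
    intro τ hτ
    refine ⟨1, fun n hn h => ?_⟩
    rcases eq_three_pow_or_le hn with ⟨k, rfl⟩ | h'
    · refine ⟨1, k, k, 0, one_pos, le_rfl, by simp, ?_, by simp, by simp⟩
      push_cast
      nlinarith [pow_pos (show (0 : ℝ) < 3 by norm_num) k]
    · have : 0 < n ^ 3 := by positivity
      omega
  | succ r ih =>
    intro τ hτ
    obtain ⟨σ, hσ, hσ1, hστ⟩ : ∃ σ : ℝ, 0 < σ ∧ σ ≤ 1 ∧ 3 * σ ≤ τ :=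
      ⟨min (τ / 3) 1, by positivity, min_le_right _ _, by linarith [min_le_left (τ / 3) 1]⟩
    have hσ2 : (1 + σ) * (1 + σ) ≤ 1 + τ := by nlinarith
    obtain ⟨M, hM⟩ := ih σ hσ
    -- `D` bounds the smaller summand of an efficient sum under the defect bound; when the larger
    -- summand is at least `L`, the smaller one is at most `σ` times it.
    set D := 8 * 9 ^ (r + 1) with hD
    set L := D * (3 + ⌈1 / σ⌉₊) with hL
    refine ⟨M * M + L + D + 1, fun n => ?_⟩
    -- Removing a factor that is a power of 3 need not lower `r`, so that case recurses on `n`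
    -- instead.
    induction n using Nat.strong_induction_on with
    | _ n ihn =>
    intro hn h
    rcases (show n ≤ M * M + L + D + 1 ∨ M * M + L + D + 1 < n by omega) with hle | hlt
    · refine ⟨n, 0, 0, 0, hn, hle, by simp, ?_, by simp, by simp⟩
      have : (0 : ℝ) < n := by exact_mod_cast hn
      norm_num
      nlinarith
    rcases exists_efficient_add_or_mul (show 1 < n by omega) with
      ⟨a, b, hb, hba, rfl, hc⟩ | ⟨a, b, ha, hb, rfl, hc⟩
    · have ha : 0 < a := by omega
      have hca := cube_le_three_pow_complexity ha
      have hcb := cube_le_three_pow_complexity hb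
      have h8 : 0 < 8 ^ (r + 1) := by positivity
      have hbD : b ≤ D := by
        have h1 : (a + b) ^ 3 ≤ 8 * a ^ 3 := by
          calc (a + b) ^ 3 ≤ (2 * a) ^ 3 := Nat.pow_le_pow_left (by omega) 3
            _ = 8 * a ^ 3 := by ring
        have h2 : 3 ^ complexity a * 3 ^ complexity b ≤ 3 ^ complexity a * D := by
          calc 3 ^ complexity a * 3 ^ complexity b
              ≤ 3 ^ complexity a * 3 ^ complexity b * 8 ^ (r + 1) := Nat.le_mul_of_pos_right _ h8
            _ ≤ (a + b) ^ 3 * 9 ^ (r + 1) := by rwa [← pow_add, ← hc]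
            _ ≤ 8 * a ^ 3 * 9 ^ (r + 1) := Nat.mul_le_mul_right _ h1
            _ = a ^ 3 * D := by rw [hD]; ring
            _ ≤ _ := Nat.mul_le_mul_right _ hca
        have h3 := Nat.le_of_mul_le_mul_left h2 (by positivity)
        exact (Nat.le_self_pow (by norm_num) b).trans (hcb.trans h3)
      have hLa : L ≤ a := by omega
      have hba3 : 3 * b ≤ a := by
        refine le_trans ?_ hLa
        rw [hL]
        nlinarith [Nat.zero_le (D * ⌈1 / σ⌉₊)]
      have hbσ : (b : ℝ) ≤ σ * a := by
        have h1 : (b : ℝ) ≤ D := by exact_mod_cast hbD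
        have h2 : (L : ℝ) ≤ a := by exact_mod_cast hLa
        have h3 := Nat.le_ceil (1 / σ)
        have h4 : (D : ℝ) * (1 / σ) ≤ L := by
          rw [hL]
          push_cast
          exact mul_le_mul_of_nonneg_left (by linarith) (Nat.cast_nonneg _)
        have h5 : σ * (D * (1 / σ)) = D := by field_simp
        nlinarith
      -- The summand `b` costs at least one `1`, a factor 3, while `(a + b) ^ 3 ≤ (64 / 27) * a ^
      -- 3`; since `(64 / 27) * (9 / 8) < 3`, the bound drops from `r + 1` to `r`.
      have hHa : 3 ^ complexity a * 8 ^ r ≤ a ^ 3 * 9 ^ r := by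
        have h1 : 27 * (a + b) ^ 3 ≤ 64 * a ^ 3 := by
          calc 27 * (a + b) ^ 3 = (3 * (a + b)) ^ 3 := by ring
            _ ≤ (4 * a) ^ 3 := Nat.pow_le_pow_left (by omega) 3
            _ = 64 * a ^ 3 := by ring
        have h2 : 3 ≤ 3 ^ complexity b := Nat.le_self_pow (complexity_pos hb).ne' 3
        rw [hc, pow_add, pow_succ, pow_succ 9] at h
        have h3 := Nat.mul_le_mul_left (3 ^ complexity a * 8 ^ r) h2
        have h4 := Nat.mul_le_mul_right (9 ^ r) h1
        have h5 : 8 * (3 ^ complexity a * 8 ^ r * 3 ^ complexity b) ≤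
            9 * ((a + b) ^ 3 * 9 ^ r) := by
          calc _ = 3 ^ complexity a * 3 ^ complexity b * (8 ^ r * 8) := by ring
            _ ≤ (a + b) ^ 3 * (9 ^ r * 9) := h
            _ = _ := by ring
        rw [mul_assoc] at h4
        rw [mul_assoc 64] at h4
        omega
      obtain ⟨m, k, l, j, hm, hmM, h1, h2, h3, -⟩ := hM a ha hHa
      have hcb' := complexity_pos hb
      refine ⟨m, k, l, j + 1, hm, by nlinarith, by omega, ?_, by omega, by omega⟩
      push_cast
      calc (a + b : ℝ) ≤ (1 + σ) * a := by linarith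
        _ ≤ (1 + σ) * ((1 + σ) * (m * 3 ^ k)) := by gcongr
        _ = (1 + σ) * (1 + σ) * (m * 3 ^ k) := by ring
        _ ≤ _ := by gcongr
    · have power : ∀ i c : ℕ, 0 < c → c < a * b → a * b = 3 ^ i * c →
          complexity (a * b) = complexity (3 ^ i) + complexity c →
          ∃ m k l j : ℕ, 0 < m ∧ m ≤ M * M + L + D + 1 ∧ m * 3 ^ k ≤ a * b ∧
            ((a * b : ℕ) : ℝ) ≤ (1 + τ) * (m * 3 ^ k) ∧
            complexity (3 ^ l * m) + 3 * k + j ≤ complexity (a * b) + 3 * l ∧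
            (j = 0 → a * b = m * 3 ^ k) := by
        intro i c hc0 hcn hn' hcc
        have hi : 3 * i ≤ complexity (3 ^ i) := by
          simpa using three_mul_le_complexity one_pos i
        have hHc : 3 ^ complexity c * 8 ^ (r + 1) ≤ c ^ 3 * 9 ^ (r + 1) := by
          have h1 : 3 ^ (3 * i) ≤ 3 ^ complexity (3 ^ i) :=
            Nat.pow_le_pow_right (by norm_num) hi
          refine Nat.le_of_mul_le_mul_left (c := 3 ^ (3 * i)) ?_ (by positivity)
          calc 3 ^ (3 * i) * (3 ^ complexity c * 8 ^ (r + 1))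
              ≤ 3 ^ complexity (3 ^ i) * (3 ^ complexity c * 8 ^ (r + 1)) :=
                Nat.mul_le_mul_right _ h1
            _ = 3 ^ complexity (a * b) * 8 ^ (r + 1) := by rw [hcc, pow_add 3 (complexity (3 ^ i)), mul_assoc]
            _ ≤ (a * b) ^ 3 * 9 ^ (r + 1) := h
            _ = 3 ^ (3 * i) * (c ^ 3 * 9 ^ (r + 1)) := by
              rw [hn', mul_pow, ← pow_mul, mul_comm i 3, mul_assoc]
        obtain ⟨m, k, l, j, hm, hmM, h1, h2, h3, h4⟩ := ihn c hcn hc0 hHc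
        have e : m * 3 ^ (k + i) = 3 ^ i * (m * 3 ^ k) := by ring
        refine ⟨m, k + i, l, j, hm, hmM, ?_, ?_, by omega, fun hj => ?_⟩
        · rw [e, hn']
          exact Nat.mul_le_mul_left _ h1
        · rw [hn']
          push_cast
          calc (3 : ℝ) ^ i * c ≤ 3 ^ i * ((1 + τ) * (m * 3 ^ k)) := by gcongr
            _ = _ := by ring
        · rw [e, hn', ← h4 hj]
      -- A cofactor that is not a power of 3 uses up at least `log₃ (9 / 8)` of the defect.
      have drop : ∀ c d : ℕ, 9 * d ^ 3 ≤ 8 * 3 ^ complexity d → a * b = c * d →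
          complexity (a * b) = complexity c + complexity d →
          3 ^ complexity c * 8 ^ r ≤ c ^ 3 * 9 ^ r := by
        intro c d hd hn' hcc
        rw [hcc, hn', pow_add, mul_pow, pow_succ, pow_succ 9] at h
        refine Nat.le_of_mul_le_mul_left (c := 8 * 3 ^ complexity d) ?_ (by positivity)
        calc 8 * 3 ^ complexity d * (3 ^ complexity c * 8 ^ r)
            = 3 ^ complexity c * 3 ^ complexity d * (8 ^ r * 8) := by ring
          _ ≤ c ^ 3 * d ^ 3 * (9 ^ r * 9) := h
          _ = 9 * d ^ 3 * (c ^ 3 * 9 ^ r) := by ring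
          _ ≤ _ := Nat.mul_le_mul_right _ hd
      rcases eq_three_pow_or_le (n := a) (by omega) with ⟨i, rfl⟩ | hga
      · exact power i b (by omega) (by nlinarith) rfl hc
      rcases eq_three_pow_or_le (n := b) (by omega) with ⟨i, rfl⟩ | hgb
      · exact power i a (by omega) (by nlinarith) (mul_comm _ _) (by omega)
      obtain ⟨m, k, l, j, hm, hmM, h1, h2, h3, h4⟩ := hM a (by omega) (drop a b hgb rfl hc)
      obtain ⟨m', k', l', j', hm', hmM', h1', h2', h3', h4'⟩ :=
        hM b (by omega) (drop b a hga (mul_comm _ _) (by omega))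
      have e : m * m' * 3 ^ (k + k') = m * 3 ^ k * (m' * 3 ^ k') := by ring
      have hcm := complexity_mul_le (a := 3 ^ l * m) (b := 3 ^ l' * m')
        (by positivity) (by positivity)
      have e' : 3 ^ l * m * (3 ^ l' * m') = 3 ^ (l + l') * (m * m') := by ring
      rw [e'] at hcm
      refine ⟨m * m', k + k', l + l', j + j', by positivity, ?_, ?_, ?_, by omega, ?_⟩
      · have := Nat.mul_le_mul hmM hmM'
        omega
      · rw [e]
        exact Nat.mul_le_mul h1 h1'
      · push_cast
        calc (a * b : ℝ) ≤ (1 + σ) * (m * 3 ^ k) * ((1 + σ) * (m' * 3 ^ k')) := by gcongr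
          _ = (1 + σ) * (1 + σ) * (m * m' * 3 ^ (k + k')) := by ring
          _ ≤ _ := by gcongr
      · intro hj
        rw [e, ← h4 (by omega), ← h4' (by omega)]

/-! ### Defects -/

theorem defect_three_pow_mul {n : ℕ} (hn : 0 < n) (k : ℕ) :
    defect (3 ^ k * n) = complexity (3 ^ k * n) - 3 * k - 3 * Real.logb 3 n := by
  have hn' : (n : ℝ) ≠ 0 := by positivity
  rw [defect, Nat.cast_mul, Real.logb_mul (by positivity) hn']
  push_cast
  rw [Real.logb_pow, Real.logb_self_eq_one (by norm_num)]
  ring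

theorem IsStable.defect_three_pow_mul {n : ℕ} (h : IsStable n) (hn : 0 < n) (k : ℕ) :
    defect (3 ^ k * n) = defect n := by
  rw [IntegerComplexity.defect_three_pow_mul hn, h, defect]
  push_cast
  ring

theorem defect_nonneg {n : ℕ} (hn : 0 < n) : 0 ≤ defect n := by
  have h : (n : ℝ) ^ 3 ≤ 3 ^ complexity n := by exact_mod_cast cube_le_three_pow_complexity hn
  have h' := Real.logb_le_logb_of_le (b := 3) (by norm_num) (by positivity) h
  rw [Real.logb_pow, Real.logb_pow, Real.logb_self_eq_one (by norm_num)] at h'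
  rw [defect]
  push_cast at h'
  linarith

theorem three_pow_complexity_mul_le_of_defect_le {n : ℕ} (hn : 0 < n) {r : ℕ}
    (h : defect n ≤ r * Real.logb 3 (9 / 8)) :
    3 ^ complexity n * 8 ^ r ≤ n ^ 3 * 9 ^ r := by
  have hn' : (0 : ℝ) < n := by exact_mod_cast hn
  have h' : (3 : ℝ) ^ complexity n * 8 ^ r ≤ n ^ 3 * 9 ^ r := by
    rw [← Real.logb_le_logb (b := 3) (by norm_num) (by positivity) (by positivity),
      Real.logb_mul (by positivity) (by positivity), Real.logb_mul (by positivity) (by positivity),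
      Real.logb_pow, Real.logb_pow, Real.logb_pow, Real.logb_pow,
      Real.logb_self_eq_one (by norm_num)]
    rw [defect, Real.logb_div (by norm_num) (by norm_num)] at h
    push_cast
    linarith
  exact_mod_cast h'

theorem logb_three_one_add_le {t : ℝ} (ht : 0 ≤ t) : Real.logb 3 (1 + t) ≤ t := by
  have h1 : 1 ≤ Real.log 3 := by
    rw [Real.le_log_iff_exp_le (by norm_num)]
    linarith [Real.exp_one_lt_d9]
  have h2 := Real.log_le_sub_one_of_pos (show 0 < 1 + t by linarith)
  rw [Real.logb, div_le_iff₀ (by linarith)]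
  nlinarith

theorem eq_three_pow_mul_of_cube_eq {m n a : ℕ} (hn : 0 < n) (h : m ^ 3 = n ^ 3 * 3 ^ a) :
    ∃ q, m = 3 ^ q * n := by
  obtain ⟨c, rfl⟩ : n ∣ m := (Nat.pow_dvd_pow_iff (by norm_num)).1 ⟨_, h⟩
  rw [mul_pow] at h
  have hc : c ^ 3 = 3 ^ a := Nat.eq_of_mul_eq_mul_left (by positivity) h
  obtain ⟨q, -, rfl⟩ := (Nat.dvd_prime_pow Nat.prime_three).1 (hc ▸ dvd_pow_self c (by norm_num))
  exact ⟨q, mul_comm _ _⟩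

/-- Two numbers whose defects differ by an integer have a power of `3` as their ratio. -/
theorem eq_three_pow_mul_of_defect_sub {m n : ℕ} (hm : 0 < m) (hn : 0 < n) {z : ℤ}
    (h : defect n - defect m = z) : ∃ q, n = 3 ^ q * m ∨ m = 3 ^ q * n := by
  have key : ∀ {m n : ℕ}, 0 < m → 0 < n → ∀ a : ℕ,
      3 * Real.logb 3 m = 3 * Real.logb 3 n + a → ∃ q, m = 3 ^ q * n := by
    intro m n hm hn a h
    have hm' : (0 : ℝ) < m := by exact_mod_cast hm
    have hn' : (0 : ℝ) < n := by exact_mod_cast hn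
    refine eq_three_pow_mul_of_cube_eq (a := a) hn ?_
    have h' : (m : ℝ) ^ 3 = n ^ 3 * 3 ^ a := by
      refine Real.logb_injOn_pos (b := 3) (by norm_num) (Set.mem_Ioi.2 (by positivity))
        (Set.mem_Ioi.2 (by positivity)) ?_
      rw [Real.logb_mul (by positivity) (by positivity), Real.logb_pow, Real.logb_pow,
        Real.logb_pow, Real.logb_self_eq_one (by norm_num)]
      push_cast
      linarith
    exact_mod_cast h'
  obtain ⟨a, ha⟩ := Int.eq_nat_or_neg (z + complexity m - complexity n)
  simp only [defect] at h
  rcases ha with ha | ha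
  · have ha' : (z + complexity m - complexity n : ℝ) = a := by exact_mod_cast ha
    obtain ⟨q, hq⟩ := key hm hn a (by linarith)
    exact ⟨q, .inr hq⟩
  · have ha' : (z + complexity m - complexity n : ℝ) = -a := by exact_mod_cast ha
    obtain ⟨q, hq⟩ := key hn hm a (by linarith)
    exact ⟨q, .inl hq⟩

/-- The two numbers differ by a power of 3, which leaves a stable defect unchanged. -/
theorem IsStable.defect_eq_of_sub_eq_int {m n : ℕ} (hm : 0 < m) (hn : 0 < n) (hms : IsStable m)
    (hns : IsStable n) {z : ℤ} (h : defect n - defect m = z) : defect n = defect m := by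
  obtain ⟨q, rfl | rfl⟩ := eq_three_pow_mul_of_defect_sub hm hn h
  · exact hms.defect_three_pow_mul hm q
  · exact (hns.defect_three_pow_mul hn q).symm

theorem complexity_cast_eq_of_defect_eq {m n : ℕ} (hm : 0 < m) (hn : 0 < n)
    (h : defect n = defect m) : (complexity n : ZMod 3) = complexity m := by
  have key : ∀ {m : ℕ}, 0 < m → ∀ q : ℕ, defect (3 ^ q * m) = defect m →
      (complexity (3 ^ q * m) : ZMod 3) = complexity m := by
    intro m hm q h
    rw [defect_three_pow_mul hm, defect] at h
    have h' : complexity (3 ^ q * m) = 3 * q + complexity m := by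
      have : (complexity (3 ^ q * m) : ℝ) = 3 * q + complexity m := by linarith
      exact_mod_cast this
    rw [h']
    push_cast
    rw [show (3 : ZMod 3) = 0 from rfl, zero_mul, zero_add]
  obtain ⟨q, rfl | rfl⟩ :=
    eq_three_pow_mul_of_defect_sub hm hn (z := 0) (by rw [h, sub_self, Int.cast_zero])
  · exact key hm q h
  · exact (key hn q h.symm).symm

/-- The two sets intersected may have different witnesses for `x`; the defect determines the
complexity modulo 3, so the stable witness serves for both. -/
theorem mem_stableDefectsMod {u : ZMod 3} {x : ℝ} : x ∈ stableDefectsMod u ↔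
    ∃ n : ℕ, 0 < n ∧ IsStable n ∧ (complexity n : ZMod 3) = u ∧ defect n = x := by
  constructor
  · rintro ⟨⟨n, hn, hu, hx⟩, m, hm, hms, hx'⟩
    refine ⟨m, hm, hms, ?_, hx'⟩
    rw [← hu]
    exact complexity_cast_eq_of_defect_eq (by omega) hm (hx'.trans hx.symm)
  · rintro ⟨n, hn, hs, hu, hx⟩
    exact ⟨⟨n, hs.one_lt hn, hu, hx⟩, n, hn, hs, hx⟩

/-! ### Limit points of the stable defects -/

open Topology Filter

theorem exists_sub_mem_closure_of_mem_derivedSet {u : ZMod 3} {η : ℝ}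
    (hη : η ∈ derivedSet (stableDefectsMod u)) :
    ∃ j : ℕ, 1 ≤ j ∧ η - j ∈ closure (stableDefectsMod (u - j)) := by
  -- Bounding `j` makes the union finite, so that closure commutes with it and one `j` works for all
  -- `ε₀`.
  have key : η ∈ closure (⋃ j ∈ Finset.Icc 1 ⌈η + 1⌉₊,
      (fun x : ℝ => x + j) '' stableDefectsMod (u - j)) := by
    rw [Metric.mem_closure_iff]
    intro ε₀ hε₀
    obtain ⟨ε, hε, hε1, hεε⟩ : ∃ ε : ℝ, 0 < ε ∧ ε ≤ 1 ∧ ε ≤ ε₀ :=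
      ⟨min ε₀ 1, by positivity, min_le_right _ _, min_le_left _ _⟩
    obtain ⟨r, hr⟩ := Archimedean.arch (η + 1)
      (Real.logb_pos (b := 3) (x := 9 / 8) (by norm_num) (by norm_num))
    rw [nsmul_eq_mul] at hr
    obtain ⟨M, hM⟩ := exists_bounded_approx r (ε / 6) (by positivity)
    have hK : ∀ m : ℕ, ∃ k, 0 < m → IsStable (3 ^ k * m) := fun m => by
      rcases Nat.eq_zero_or_pos m with rfl | hm
      · exact ⟨0, fun h => absurd h (lt_irrefl _)⟩
      · exact (exists_isStable hm).imp fun _ h _ => h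
    choose K hK using hK
    set F : Set ℝ := (fun m : ℕ => defect (3 ^ K m * m)) '' Set.Icc 1 M with hF
    have hFfin : F.Finite := (Set.finite_Icc 1 M).image _
    -- A point of this neighbourhood other than `η` avoids all of `F`, which rules out `n = m * 3 ^
    -- k`.
    have hU : Metric.ball η (ε / 2) ∩ (F \ {η})ᶜ ∈ 𝓝 η :=
      inter_mem (Metric.ball_mem_nhds _ (by positivity))
        ((hFfin.subset Set.sdiff_subset).isClosed.isOpen_compl.mem_nhds (by simp))
    obtain ⟨x, ⟨⟨hxη, hxF⟩, hxT⟩, hne⟩ := accPt_iff_nhds.1 hη _ hU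
    have hxF : x ∉ F := fun h => hxF ⟨h, hne⟩
    rw [Metric.mem_ball, Real.dist_eq, abs_lt] at hxη
    obtain ⟨n, hn, hs, hu, rfl⟩ := mem_stableDefectsMod.1 hxT
    obtain ⟨m, k, l, j, hm, hmM, h1, h2, h3, h4⟩ := hM n hn
      (three_pow_complexity_mul_le_of_defect_le hn (by linarith))
    have hj : 1 ≤ j := by
      by_contra hj
      obtain rfl := h4 (by omega)
      refine hxF ⟨m, ⟨hm, hmM⟩, ?_⟩
      have e1 := hs.defect_three_pow_mul hn (K m)
      have e2 := (hK m hm).defect_three_pow_mul (by positivity) k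
      refine e2.symm.trans (Eq.trans ?_ e1)
      congr 1
      ring
    have hq : 0 < 3 ^ l * m := by positivity
    have hqs : IsStable (3 ^ (l + K m) * m) := by
      rw [pow_add, mul_assoc]
      exact (hK m hm).three_pow_mul l
    have hqc : complexity (3 ^ (l + K m) * m) ≤ 3 * K m + complexity (3 ^ l * m) := by
      rw [add_comm, pow_add, mul_assoc]
      exact complexity_three_pow_mul_le hq _
    -- `J ≥ j` is the exact saving once `m` is replaced by a stable multiple; exactness fixes the
    -- class modulo 3.
    obtain ⟨J, hJ⟩ : ∃ J, complexity (3 ^ (l + K m) * m) + 3 * k + J =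
        complexity n + 3 * (l + K m) :=
      ⟨complexity n + 3 * (l + K m) - (complexity (3 ^ (l + K m) * m) + 3 * k), by omega⟩
    have hm' : (0 : ℝ) < m := by exact_mod_cast hm
    have hn' : (0 : ℝ) < n := by exact_mod_cast hn
    have hlog : Real.logb 3 (m * 3 ^ k) = Real.logb 3 m + k := by
      rw [Real.logb_mul (by positivity) (by positivity), Real.logb_pow,
        Real.logb_self_eq_one (by norm_num), mul_one]
    have hJr : (complexity (3 ^ (l + K m) * m) : ℝ) + 3 * k + J =
        complexity n + 3 * (l + K m) := by exact_mod_cast hJ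
    have hd : defect (3 ^ (l + K m) * m) + J = complexity n - 3 * Real.logb 3 (m * 3 ^ k) := by
      rw [defect_three_pow_mul hm, hlog]
      push_cast
      linarith
    have hlow : Real.logb 3 (m * 3 ^ k) ≤ Real.logb 3 n :=
      Real.logb_le_logb_of_le (by norm_num) (by positivity) (by exact_mod_cast h1)
    have hupp : Real.logb 3 n ≤ ε / 6 + Real.logb 3 (m * 3 ^ k) := by
      have h5 := Real.logb_le_logb_of_le (b := 3) (by norm_num) hn' h2
      rw [Real.logb_mul (by positivity) (by positivity)] at h5
      linarith [logb_three_one_add_le (t := ε / 6) (by positivity)]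
    have hdn : defect n = complexity n - 3 * Real.logb 3 n := rfl
    have hd0 := defect_nonneg (n := 3 ^ (l + K m) * m) (by positivity)
    refine ⟨defect (3 ^ (l + K m) * m) + J, ?_, ?_⟩
    · simp only [Set.mem_iUnion]
      refine ⟨J, Finset.mem_Icc.2 ⟨by omega, ?_⟩, _, mem_stableDefectsMod.2
        ⟨_, by positivity, hqs, ?_, rfl⟩, rfl⟩
      · have h6 : (J : ℝ) ≤ (⌈η + 1⌉₊ : ℕ) := le_trans (by linarith) (Nat.le_ceil _)
        exact_mod_cast h6
      · have h7 := congrArg (Nat.cast : ℕ → ZMod 3) hJ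
        push_cast at h7
        rw [show (3 : ZMod 3) = 0 from rfl, zero_mul, zero_mul, add_zero, add_zero, hu] at h7
        exact eq_sub_of_add_eq h7
    · rw [Real.dist_eq, abs_lt]
      constructor <;> linarith
  rw [Finset.closure_biUnion] at key
  simp only [Set.mem_iUnion, Finset.mem_Icc] at key
  obtain ⟨j, hj, h⟩ := key
  refine ⟨j, hj.1, ?_⟩
  have e := (Homeomorph.addRight (j : ℝ)).image_closure (stableDefectsMod (u - j))
  simp only [Homeomorph.coe_addRight] at e
  rw [← e] at h
  obtain ⟨y, hy, rfl⟩ := h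
  simpa using hy

theorem closure_stableDefectsMod_subset_Ici (u : ZMod 3) :
    closure (stableDefectsMod u) ⊆ Set.Ici 0 := by
  refine closure_minimal ?_ isClosed_Ici
  intro x hx
  obtain ⟨n, hn, -, -, rfl⟩ := mem_stableDefectsMod.1 hx
  exact defect_nonneg hn

/-- Every limit point of the stable defects is a stable defect plus a positive integer. -/
theorem exists_defect_add_of_mem_derivedSet {u : ZMod 3} {η : ℝ}
    (hη : η ∈ derivedSet (stableDefectsMod u)) :
    ∃ m j : ℕ, 0 < m ∧ IsStable m ∧ 1 ≤ j ∧ (complexity m : ZMod 3) = u - j ∧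
      η = defect m + j := by
  obtain ⟨N, hN⟩ := exists_nat_gt η
  induction N generalizing u η with
  | zero =>
    have := closure_stableDefectsMod_subset_Ici u (derivedSet_subset_closure _ hη)
    rw [Set.mem_Ici] at this
    push_cast at hN
    linarith
  | succ N ih =>
    obtain ⟨j, hj, h⟩ := exists_sub_mem_closure_of_mem_derivedSet hη
    rw [closure_eq_self_union_derivedSet] at h
    rcases h with h | h
    · obtain ⟨m, hm, hs, hu, hd⟩ := mem_stableDefectsMod.1 h
      exact ⟨m, j, hm, hs, hj, hu, by linarith⟩
    · have hj' : (1 : ℝ) ≤ j := by exact_mod_cast hj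
      push_cast at hN
      obtain ⟨m, i, hm, hs, hi, hu, hd⟩ := ih h (by linarith)
      refine ⟨m, i + j, hm, hs, by omega, ?_, by push_cast; linarith⟩
      rw [hu]
      push_cast
      ring

theorem exists_frequently_eq_of_le {f : ℕ → ℕ} {B : ℕ} (hf : ∀ k, f k ≤ B) :
    ∃ j, ∃ᶠ k in atTop, f k = j := by
  by_contra h
  simp only [not_exists, not_frequently] at h
  have h' := (Finset.range (B + 1)).eventually_all.2 fun j _ => h j
  obtain ⟨k, hk⟩ := h'.exists
  exact hk (f k) (Finset.mem_range.2 (Nat.lt_succ_of_le (hf k))) rfl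

theorem tendsto_logb_three_pow_mul_add_one {n : ℕ} (hn : 0 < n) :
    Tendsto (fun k : ℕ => Real.logb 3 (1 + 1 / ((3 : ℝ) ^ k * n))) atTop (𝓝 0) := by
  have hn' : (0 : ℝ) < n := by exact_mod_cast hn
  have h1 : Tendsto (fun k : ℕ => 1 / ((3 : ℝ) ^ k * n)) atTop (𝓝 0) := by
    simp_rw [one_div]
    exact tendsto_inv_atTop_zero.comp
      ((tendsto_pow_atTop_atTop_of_one_lt (by norm_num)).atTop_mul_const hn')
  refine tendsto_of_tendsto_of_tendsto_of_le_of_le tendsto_const_nhds h1 (fun k => ?_) fun k => ?_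
  · refine Real.logb_nonneg (by norm_num) ?_
    have : 0 < 1 / ((3 : ℝ) ^ k * n) := by positivity
    linarith
  · exact logb_three_one_add_le (by positivity)

/-- The numbers `3 ^ k * n + 1` show that `δ(n) + 1` is a limit point of stable defects. -/
theorem defect_add_one_mem_derivedSet {u : ZMod 3} {n : ℕ} (hn : 0 < n) (hs : IsStable n)
    (hu : (complexity n : ZMod 3) = u - 1) :
    defect n + 1 ∈ derivedSet (stableDefectsMod u) := by
  have hn' : (0 : ℝ) < n := by exact_mod_cast hn
  choose l hl using fun k : ℕ => exists_isStable (Nat.succ_pos (3 ^ k * n))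
  simp only [Nat.succ_eq_add_one] at hl
  set e : ℕ → ℝ := fun k => Real.logb 3 (1 + 1 / ((3 : ℝ) ^ k * n)) with he
  have he0 : ∀ k, 0 < e k := fun k => by
    refine Real.logb_pos (by norm_num) ?_
    have : 0 < 1 / ((3 : ℝ) ^ k * n) := by positivity
    linarith
  have hJ : ∀ k, ∃ J, complexity (3 ^ l k * (3 ^ k * n + 1)) + J =
      3 * l k + 3 * k + complexity n + 1 := fun k => by
    have h1 := complexity_three_pow_mul_le (Nat.succ_pos (3 ^ k * n)) (l k)
    have h2 := complexity_add_le (a := 3 ^ k * n) (by positivity) one_pos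
    have h3 := hs k
    rw [complexity_one] at h2
    simp only [Nat.succ_eq_add_one] at h1
    exact Nat.exists_eq_add_of_le (by omega) |>.imp fun _ h => h.symm
  -- `J k` counts the ones that the stabilised `3 ^ k * n + 1` saves over the obvious expression.
  choose J hJ using hJ
  have hd : ∀ k, defect (3 ^ l k * (3 ^ k * n + 1)) = defect n + 1 - J k - 3 * e k := fun k => by
    have h1 : (complexity (3 ^ l k * (3 ^ k * n + 1)) : ℝ) + J k =
      3 * l k + 3 * k + complexity n + 1 := by exact_mod_cast hJ k
    have h2 : ((3 ^ k * n + 1 : ℕ) : ℝ) = 3 ^ k * (n * (1 + 1 / ((3 : ℝ) ^ k * n))) := by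
      push_cast
      field_simp
    rw [defect_three_pow_mul (Nat.succ_pos _), h2, Real.logb_mul (by positivity) (by positivity),
      Real.logb_mul (by positivity) (by positivity), Real.logb_pow,
      Real.logb_self_eq_one (by norm_num), defect]
    simp only [he]
    linarith
  have hB : ∀ k, J k ≤ ⌈defect n + 1⌉₊ := fun k => by
    have h1 := defect_nonneg (n := 3 ^ l k * (3 ^ k * n + 1)) (by positivity)
    have h2 : (J k : ℝ) ≤ (⌈defect n + 1⌉₊ : ℕ) :=
      le_trans (by linarith [hd k, he0 k]) (Nat.le_ceil _)
    exact_mod_cast h2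
  obtain ⟨j, hj⟩ := exists_frequently_eq_of_le hB
  have hlim : defect n + 1 - j ∈ derivedSet (stableDefectsMod (u - j)) := by
    rw [mem_derivedSet, accPt_iff_frequently]
    have ht : Tendsto (fun k => defect n + 1 - j - 3 * e k) atTop (𝓝 (defect n + 1 - j)) := by
      have h := ((tendsto_logb_three_pow_mul_add_one hn).const_mul 3).const_sub
        (defect n + 1 - j)
      rwa [mul_zero, sub_zero] at h
    refine ht.frequently (hj.mono fun k hk => ⟨by linarith [he0 k], ?_⟩)
    refine mem_stableDefectsMod.2 ⟨_, by positivity, hl k, ?_, by rw [hd, hk]⟩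
    have h7 := congrArg (Nat.cast : ℕ → ZMod 3) (hJ k)
    push_cast at h7
    rw [show (3 : ZMod 3) = 0 from rfl, zero_mul, zero_mul, zero_add, zero_add, hu,
      sub_add_cancel, hk] at h7
    exact eq_sub_of_add_eq h7
  -- Now `δ(n) + 1 - j = δ(m) + i` with `i ≥ 1`; the stable defects differ by an integer, so they
  -- agree and `i + j = 1`, whence `j = 0`.
  obtain ⟨m, i, hm, hms, hi, -, hmi⟩ := exists_defect_add_of_mem_derivedSet hlim
  have heq := IsStable.defect_eq_of_sub_eq_int hm hn hms hs (z := i + j - 1)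
    (by push_cast; linarith)
  have hij : i + j = 1 := by
    have : (i + j : ℝ) = 1 := by linarith
    exact_mod_cast this
  obtain rfl : j = 0 := by omega
  simpa using hlim

theorem image_add_one_closure_subset (u : ZMod 3) :
    (fun x : ℝ => x + 1) '' closure (stableDefectsMod (u - 1)) ⊆
      derivedSet (stableDefectsMod u) := by
  refine (image_closure_subset_closure_image (by fun_prop)).trans
    (closure_minimal ?_ (isClosed_derivedSet _))
  rintro _ ⟨x, hx, rfl⟩
  obtain ⟨n, hn, hs, hu, rfl⟩ := mem_stableDefectsMod.1 hx
  exact defect_add_one_mem_derivedSet hn hs hu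

theorem defect_add_mem_closure {m : ℕ} (hm : 0 < m) (hs : IsStable m) (j : ℕ) {u : ZMod 3}
    (hu : (complexity m : ZMod 3) = u - j) :
    defect m + j ∈ closure (stableDefectsMod u) := by
  induction j generalizing u with
  | zero =>
    refine subset_closure (mem_stableDefectsMod.2 ⟨m, hm, hs, by simpa using hu, by simp⟩)
  | succ j ih =>
    refine derivedSet_subset_closure _ (image_add_one_closure_subset u ⟨_, ih (u := u - 1) ?_, ?_⟩)
    · rw [hu]
      push_cast
      ring
    · push_cast
      ring

/-- For a limit point `δ(m) + j` with `j ≥ 1`, one unit is split off; the remaining `j - 1` stay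
within the closure by iterating the reverse inclusion. -/
theorem derivedSet_closure_stableDefectsMod (u : ZMod 3) :
    derivedSet (closure (stableDefectsMod u)) =
      (fun x : ℝ => x + 1) '' closure (stableDefectsMod (u - 1)) := by
  rw [derivedSet_closure]
  refine Set.Subset.antisymm (fun η hη => ?_) (image_add_one_closure_subset u)
  obtain ⟨m, j, hm, hs, hj, hu, rfl⟩ := exists_defect_add_of_mem_derivedSet hη
  obtain ⟨j, rfl⟩ := Nat.exists_eq_add_of_le' hj
  refine ⟨defect m + j, defect_add_mem_closure hm hs j ?_, by push_cast; ring⟩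
  rw [hu]
  push_cast
  ring

theorem derivedSet_image_add (c : ℝ) (S : Set ℝ) :
    derivedSet ((fun x => x + c) '' S) = (fun x => x + c) '' derivedSet S := by
  refine Set.Subset.antisymm (fun y hy => ⟨y - c, ?_, sub_add_cancel y c⟩)
    (Continuous.image_derivedSet (by fun_prop) (add_left_injective c))
  have h := Continuous.image_derivedSet (f := fun x : ℝ => x - c)
    (A := (fun x => x + c) '' S) (by fun_prop) (sub_left_injective) ⟨y, hy, rfl⟩
  simpa only [Set.image_image, add_sub_cancel_right, Set.image_id'] using h

end IntegerComplexity

theorem mainTheorem11 (u : ZMod 3) :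
    derivedSet (closure (IntegerComplexity.stableDefectsMod u)) =
        (fun x : ℝ => x + 1) '' closure (IntegerComplexity.stableDefectsMod (u - 1)) ∧
      derivedSet (derivedSet (derivedSet (closure (IntegerComplexity.stableDefectsMod u)))) =
        (fun x : ℝ => x + 3) '' closure (IntegerComplexity.stableDefectsMod u) := by
  refine ⟨IntegerComplexity.derivedSet_closure_stableDefectsMod u, ?_⟩
  have hu : u - 1 - 1 - 1 = u := by
    rw [sub_sub, sub_sub, show (1 + (1 + 1) : ZMod 3) = 0 from rfl, sub_zero]
  rw [IntegerComplexity.derivedSet_closure_stableDefectsMod u,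
    IntegerComplexity.derivedSet_image_add, IntegerComplexity.derivedSet_image_add,
    IntegerComplexity.derivedSet_closure_stableDefectsMod (u - 1),
    IntegerComplexity.derivedSet_image_add,
    IntegerComplexity.derivedSet_closure_stableDefectsMod (u - 1 - 1), hu, Set.image_image,
    Set.image_image]
  norm_num [add_assoc]
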